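/- For a monoid $S$ generated by a set $A$, the Cayley graph $\Gamma(S,A)$ has vertex set $S$ and an edge from $s$ to $sa$ for all $s\in S$, $a\in A$; it is made into a geodesic metric space with the (undirected) path metric in which every edge has length $1$. A geodesic space is hyperbolic if there is $\delta$ such that, for all points $x,y,z$ and all geodesics $\alpha,\beta,\gamma$ from $x$ to $y$, from $y$ to $z$ and from $z$ to $x$ respectively, every point of $\alpha$ is at distance less than $\delta$ from $\beta\cup\gamma$. A monoid $S$ is hyperbolic if $\Gamma(S,A)$ is hyperbolic for some finite generating set $A$ of $S$. A monoid $S$ is of finite geometric type if it has a finite generating set $A$ for which there is a constant $n$ such that, for all $q\in S$ and $a\in A$, the equation $xa=q$ has at most $n$ solutions $x\in S$. Theorem. Let $S$ be a monoid of finite geometric type, and let $T$ be a subsemigroup of $S$ such that $S\setminus T$ is finite and $T$ is itself a monoid (its identity need not be that of $S$). Then: (1) if $T$ is hyperbolic, then $S$ is hyperbolic; (2) if $S$ is hyperbolic, then $T$ is hyperbolic. -/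

import Mathlib

universe u

set_option linter.unusedSectionVars false

section MetricGeometry

variable {X : Type u} [MetricSpace X]

/-- `γ` restricted to `[0, d(x,y)]` is a geodesic (isometrically parametrised) from `x` to `y`. -/
def IsGeodesic (γ : ℝ → X) (x y : X) : Prop :=
  γ 0 = x ∧ γ (dist x y) = y ∧
    ∀ s ∈ Set.Icc 0 (dist x y), ∀ t ∈ Set.Icc 0 (dist x y), dist (γ s) (γ t) = |s - t|

/-- The set of points lying on a geodesic from `x` to `y`. -/
def geodesicTrace (γ : ℝ → X) (x y : X) : Set X :=
  γ '' Set.Icc 0 (dist x y)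

/-- Any two points are joined by a geodesic. -/
def IsGeodesicSpace (X : Type u) [MetricSpace X] : Prop :=
  ∀ x y : X, ∃ γ : ℝ → X, IsGeodesic γ x y

/-- In every geodesic triangle, each point of the side from `x` to `y` is at distance less than `δ`
from the union of the two other sides. -/
def HasThinTriangles (X : Type u) [MetricSpace X] (δ : ℝ) : Prop :=
  ∀ (x y z : X) (α β γ : ℝ → X),
    IsGeodesic α x y → IsGeodesic β y z → IsGeodesic γ z x →
      ∀ u ∈ geodesicTrace α x y,
        ∃ w ∈ geodesicTrace β y z ∪ geodesicTrace γ z x, dist u w < δ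

/-- A geodesic space which is `δ`-hyperbolic for some `δ`. -/
def IsHyperbolicSpace (X : Type u) [MetricSpace X] : Prop :=
  IsGeodesicSpace X ∧ ∃ δ : ℝ, HasThinTriangles X δ

theorem IsGeodesic.refl (x : X) : IsGeodesic (fun _ => x) x x := by
  refine ⟨rfl, rfl, ?_⟩
  intro s hs t ht
  simp only [dist_self, Set.Icc_self, Set.mem_singleton_iff] at hs ht
  simp [hs, ht]

theorem IsGeodesic.symm {γ : ℝ → X} {x y : X} (h : IsGeodesic γ x y) :
    IsGeodesic (fun t => γ (dist x y - t)) y x := by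
  obtain ⟨h0, h1, h2⟩ := h
  refine ⟨by simpa using h1, by simpa [dist_comm y x] using h0, ?_⟩
  intro s hs t ht
  rw [dist_comm y x] at hs ht
  rw [h2 _ ⟨by linarith [hs.2], by linarith [hs.1]⟩ _ ⟨by linarith [ht.2], by linarith [ht.1]⟩,
    show dist x y - s - (dist x y - t) = t - s by ring, abs_sub_comm]

theorem IsGeodesic.concat {γ η : ℝ → X} {x y z : X} (h : IsGeodesic γ x y) (k : IsGeodesic η y z)
    (hd : dist x y + dist y z ≤ dist x z) :
    IsGeodesic (fun t => if t ≤ dist x y then γ t else η (t - dist x y)) x z := by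
  obtain ⟨h0, h1, h2⟩ := h
  obtain ⟨k0, k1, k2⟩ := k
  have hxy : 0 ≤ dist x y := dist_nonneg
  have hyz : 0 ≤ dist y z := dist_nonneg
  have hd' : dist x z = dist x y + dist y z := le_antisymm (dist_triangle _ _ _) hd
  have key : ∀ s t : ℝ, 0 ≤ s → s ≤ dist x y → dist x y ≤ t → t ≤ dist x z →
      dist (γ s) (η (t - dist x y)) = t - s := by
    intro s t hs hs' ht ht'
    have e1 := h2 s ⟨hs, hs'⟩ _ ⟨hxy, le_rfl⟩
    have e2 := h2 0 ⟨le_rfl, hxy⟩ s ⟨hs, hs'⟩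
    have e3 := k2 0 ⟨le_rfl, hyz⟩ (t - dist x y) ⟨by linarith, by linarith⟩
    have e4 := k2 (t - dist x y) ⟨by linarith, by linarith⟩ _ ⟨hyz, le_rfl⟩
    rw [h1, abs_sub_comm, abs_of_nonneg (by linarith)] at e1
    rw [h0, abs_sub_comm, abs_of_nonneg (by linarith)] at e2
    rw [k0, abs_sub_comm, abs_of_nonneg (by linarith)] at e3
    rw [k1, abs_sub_comm, abs_of_nonneg (by linarith)] at e4
    have i1 := dist_triangle (γ s) y (η (t - dist x y))
    have i2 := dist_triangle x (γ s) z
    have i3 := dist_triangle (γ s) (η (t - dist x y)) z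
    linarith
  refine ⟨by simp [h0], ?_, ?_⟩
  · by_cases hz : dist x z ≤ dist x y
    · have : y = z := dist_le_zero.1 (by linarith)
      subst this
      simpa using h1
    · simp only [hz, if_false]
      rw [hd', add_sub_cancel_left, k1]
  · intro s hs t ht
    by_cases h3 : s ≤ dist x y <;> by_cases h4 : t ≤ dist x y <;> simp only [h3, h4, if_true, if_false]
    · exact h2 s ⟨hs.1, h3⟩ t ⟨ht.1, h4⟩
    · push Not at h4
      rw [key s t hs.1 h3 h4.le ht.2, abs_sub_comm, abs_of_nonneg (by linarith)]
    · push Not at h3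
      rw [dist_comm, key t s ht.1 h4 h3.le hs.2, abs_of_nonneg (by linarith)]
    · push Not at h3 h4
      rw [k2 _ ⟨by linarith, by linarith [hs.2]⟩ _ ⟨by linarith, by linarith [ht.2]⟩,
        sub_sub_sub_cancel_right]

end MetricGeometry

section Cayley

variable {S : Type u} [Monoid S]

/-- The underlying undirected simple graph of the (right) Cayley graph with edges `s → s * a`,
`a ∈ A`. Loops and repeated edges do not affect distances between vertices. -/
def cayleyGraph (A : Set S) : SimpleGraph S :=
  SimpleGraph.fromRel fun u v => ∃ a ∈ A, u * a = v

theorem cayleyGraph_reachable_mul (A : Set S) (s : S) {a : S} (ha : a ∈ A) :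
    (cayleyGraph A).Reachable s (s * a) := by
  by_cases h : s = s * a
  · rw [← h]
  · exact SimpleGraph.Adj.reachable ⟨h, Or.inl ⟨a, ha, rfl⟩⟩

theorem cayleyGraph_connected {A : Set S} (hA : Submonoid.closure A = ⊤) :
    (cayleyGraph A).Connected := by
  have h1 : ∀ s : S, (cayleyGraph A).Reachable 1 s := by
    intro s
    have hs : s ∈ Submonoid.closure A := by rw [hA]; trivial
    induction hs using Submonoid.closure_induction_right with
    | one => exact SimpleGraph.Reachable.refl _
    | mul_right x _ y hy ih => exact ih.trans (cayleyGraph_reachable_mul A x hy)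
  have : Nonempty S := ⟨1⟩
  exact SimpleGraph.Connected.mk fun u v => (h1 u).symm.trans (h1 v)

/-- Length of a shortest undirected path between two vertices of the Cayley graph. -/
noncomputable def vertexDist (A : Set S) (u v : S) : ℝ :=
  ((cayleyGraph A).dist u v : ℝ)

/-- Points of the geometric realisation of the Cayley graph `Γ(S, A)`: the vertices, and for each
edge `s → s * a` labelled `a ∈ A` the interior points of a unit interval; `edge s a t` is the point
at position `t` along that edge, counted from `s`. -/
inductive CayleyPoint {S : Type u} (A : Set S) : Type u
  | vertex (s : S) : CayleyPoint A
  | edge (s : S) (a : A) (t : Set.Ioo (0 : ℝ) 1) : CayleyPoint A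

namespace CayleyPoint

variable {A : Set S}

/-- Initial vertex of the edge carrying a point. -/
def src : CayleyPoint A → S
  | vertex s => s
  | edge s _ _ => s

/-- Terminal vertex of the edge carrying a point. -/
def tgt : CayleyPoint A → S
  | vertex s => s
  | edge s a _ => s * a

/-- Length of the part of the edge from its initial vertex to the point. -/
def pos : CayleyPoint A → ℝ
  | vertex _ => 0
  | edge _ _ t => t

/-- Length of the part of the edge from the point to its terminal vertex. -/
def rem : CayleyPoint A → ℝ
  | vertex _ => 0
  | edge _ _ t => 1 - t

/-- Both points are interior points of one and the same edge. -/
def SameEdge : CayleyPoint A → CayleyPoint A → Prop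
  | edge s a _, edge s' a' _ => s = s' ∧ a = a'
  | _, _ => False

/-- Length of a shortest path from the point `p` to the vertex `v`. -/
noncomputable def toVertex (p : CayleyPoint A) (v : S) : ℝ :=
  min (pos p + vertexDist A (src p) v) (rem p + vertexDist A (tgt p) v)

/-- Length of a shortest path from `p` to `q` among those passing through an end of the edge
carrying `p` and an end of the edge carrying `q`. -/
noncomputable def through (p q : CayleyPoint A) : ℝ :=
  min (toVertex p (src q) + pos q) (toVertex p (tgt q) + rem q)

open Classical in
/-- The path metric on the Cayley graph in which every edge has length `1`. -/
noncomputable def pathDist (p q : CayleyPoint A) : ℝ :=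
  if SameEdge p q then min |pos p - pos q| (through p q) else through p q

theorem vertexDist_self (u : S) : vertexDist A u u = 0 := by simp [vertexDist]

theorem vertexDist_nonneg (u v : S) : 0 ≤ vertexDist A u v := by simp [vertexDist]

theorem vertexDist_comm (u v : S) : vertexDist A u v = vertexDist A v u := by
  simp [vertexDist, SimpleGraph.dist_comm]

theorem vertexDist_triangle (hA : Submonoid.closure A = ⊤) (u v w : S) :
    vertexDist A u w ≤ vertexDist A u v + vertexDist A v w := by
  unfold vertexDist
  exact_mod_cast (cayleyGraph_connected hA).dist_triangle

theorem pos_nonneg (p : CayleyPoint A) : 0 ≤ pos p := by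
  cases p with
  | vertex s => exact le_rfl
  | edge s a t => exact t.2.1.le

theorem rem_nonneg (p : CayleyPoint A) : 0 ≤ rem p := by
  cases p with
  | vertex s => exact le_rfl
  | edge s a t => exact sub_nonneg.2 t.2.2.le

theorem vertexDist_src_tgt (p : CayleyPoint A) :
    vertexDist A (src p) (tgt p) ≤ pos p + rem p := by
  cases p with
  | vertex s => simp [src, tgt, pos, rem, vertexDist_self]
  | edge s a t =>
    simp only [src, tgt, pos, rem, add_sub_cancel]
    by_cases h : s = s * a
    · rw [← h, vertexDist_self]; exact zero_le_one
    · have hadj : (cayleyGraph A).Adj s (s * a) := ⟨h, Or.inl ⟨a, a.2, rfl⟩⟩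
      simp [vertexDist, SimpleGraph.dist_eq_one_iff_adj.2 hadj]

theorem SameEdge.symm {p q : CayleyPoint A} (h : SameEdge p q) : SameEdge q p := by
  cases p <;> cases q <;> simp_all [SameEdge]

theorem SameEdge.trans {p q r : CayleyPoint A} (h : SameEdge p q) (k : SameEdge q r) :
    SameEdge p r := by
  cases p <;> cases q <;> cases r <;> simp_all [SameEdge]

theorem SameEdge.src_eq {p q : CayleyPoint A} (h : SameEdge p q) : src p = src q := by
  cases p <;> cases q <;> simp_all [SameEdge, src]

theorem SameEdge.tgt_eq {p q : CayleyPoint A} (h : SameEdge p q) : tgt p = tgt q := by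
  cases p <;> cases q <;> simp_all [SameEdge, tgt]

theorem SameEdge.rem_eq {p q : CayleyPoint A} (h : SameEdge p q) :
    rem p = 1 - pos p ∧ rem q = 1 - pos q := by
  cases p <;> cases q <;> simp_all [SameEdge, pos, rem]

theorem toVertex_triangle (hA : Submonoid.closure A = ⊤) (p : CayleyPoint A) (v w : S) :
    toVertex p w ≤ toVertex p v + vertexDist A v w := by
  have h1 := vertexDist_triangle hA (src p) v w
  have h2 := vertexDist_triangle hA (tgt p) v w
  unfold toVertex
  rcases min_cases (pos p + vertexDist A (src p) v) (rem p + vertexDist A (tgt p) v) with h | h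
  · rw [h.1]; exact (min_le_left _ _).trans (by linarith)
  · rw [h.1]; exact (min_le_right _ _).trans (by linarith)

theorem toVertex_src (p : CayleyPoint A) : toVertex p (src p) ≤ pos p :=
  (min_le_left _ _).trans (by rw [vertexDist_self]; linarith)

theorem toVertex_tgt (p : CayleyPoint A) : toVertex p (tgt p) ≤ rem p :=
  (min_le_right _ _).trans (by rw [vertexDist_self]; linarith)

theorem toVertex_nonneg (p : CayleyPoint A) (v : S) : 0 ≤ toVertex p v :=
  le_min (add_nonneg (pos_nonneg p) (vertexDist_nonneg _ _))
    (add_nonneg (rem_nonneg p) (vertexDist_nonneg _ _))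

theorem through_le (hA : Submonoid.closure A = ⊤) (p q : CayleyPoint A) (v : S) :
    through p q ≤ toVertex p v + toVertex q v := by
  have h1 := toVertex_triangle hA p v (src q)
  have h2 := toVertex_triangle hA p v (tgt q)
  rw [vertexDist_comm] at h1 h2
  change _ ≤ toVertex p v + min _ _
  rcases min_cases (pos q + vertexDist A (src q) v) (rem q + vertexDist A (tgt q) v) with h | h
  · rw [h.1]; exact (min_le_left _ _).trans (by linarith)
  · rw [h.1]; exact (min_le_right _ _).trans (by linarith)

/-- A shortest path through vertices meets an end of each of the two edges. -/
theorem through_eq (p q : CayleyPoint A) :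
    ∃ v w : S, ((v = src p ∧ toVertex p v ≤ pos p) ∨ (v = tgt p ∧ toVertex p v ≤ rem p)) ∧
      ((w = src q ∧ toVertex q w ≤ pos q) ∨ (w = tgt q ∧ toVertex q w ≤ rem q)) ∧
      toVertex p v + vertexDist A v w + toVertex q w ≤ through p q := by
  have a1 := toVertex_src p
  have a2 := toVertex_tgt p
  have b1 := toVertex_src q
  have b2 := toVertex_tgt q
  have main : ∀ (w : S) (c : ℝ), toVertex q w ≤ c →
      ∃ v : S, ((v = src p ∧ toVertex p v ≤ pos p) ∨ (v = tgt p ∧ toVertex p v ≤ rem p)) ∧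
        toVertex p v + vertexDist A v w + toVertex q w ≤ toVertex p w + c := by
    intro w c hc
    rcases min_cases (pos p + vertexDist A (src p) w) (rem p + vertexDist A (tgt p) w) with h | h
    · refine ⟨src p, Or.inl ⟨rfl, a1⟩, ?_⟩
      have : toVertex p w = pos p + vertexDist A (src p) w := h.1
      linarith
    · refine ⟨tgt p, Or.inr ⟨rfl, a2⟩, ?_⟩
      have : toVertex p w = rem p + vertexDist A (tgt p) w := h.1
      linarith
  rcases min_cases (toVertex p (src q) + pos q) (toVertex p (tgt q) + rem q) with h | h
  · obtain ⟨v, hv, hv'⟩ := main _ _ b1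
    exact ⟨v, src q, hv, Or.inl ⟨rfl, b1⟩, hv'.trans h.1.ge⟩
  · obtain ⟨v, hv, hv'⟩ := main _ _ b2
    exact ⟨v, tgt q, hv, Or.inr ⟨rfl, b2⟩, hv'.trans h.1.ge⟩

theorem through_comm (hA : Submonoid.closure A = ⊤) (p q : CayleyPoint A) :
    through p q = through q p := by
  have main : ∀ p q : CayleyPoint A, through p q ≤ through q p := by
    intro p q
    obtain ⟨v, w, -, -, h⟩ := through_eq q p
    have h1 := through_le hA p q w
    have h2 := toVertex_triangle hA q v w
    linarith
  exact le_antisymm (main p q) (main q p)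

theorem through_nonneg (p q : CayleyPoint A) : 0 ≤ through p q :=
  le_min (add_nonneg (toVertex_nonneg _ _) (pos_nonneg q))
    (add_nonneg (toVertex_nonneg _ _) (rem_nonneg q))

theorem toVertex_add_ge (p : CayleyPoint A) (v w : S) (hA : Submonoid.closure A = ⊤) :
    vertexDist A v w ≤ toVertex p v + toVertex p w := by
  have h0 := vertexDist_src_tgt p
  have t1 := vertexDist_triangle hA v (src p) w
  have t2 := vertexDist_triangle hA v (tgt p) w
  have t3 := vertexDist_triangle hA (src p) (tgt p) w
  have t4 := vertexDist_triangle hA v (tgt p) (src p)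
  have c1 := vertexDist_comm (A := A) v (src p)
  have c2 := vertexDist_comm (A := A) v (tgt p)
  have c3 := vertexDist_comm (A := A) (tgt p) (src p)
  have n1 := pos_nonneg p
  have n2 := rem_nonneg p
  unfold toVertex
  rcases min_cases (pos p + vertexDist A (src p) v) (rem p + vertexDist A (tgt p) v) with h | h <;>
  rcases min_cases (pos p + vertexDist A (src p) w) (rem p + vertexDist A (tgt p) w) with k | k <;>
  rw [h.1, k.1] <;> linarith

theorem SameEdge.toVertex_le {p q : CayleyPoint A} (h : SameEdge p q) (v : S) :
    toVertex p v ≤ |pos p - pos q| + toVertex q v := by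
  have h1 := h.rem_eq
  have h2 := le_abs_self (pos p - pos q)
  have h3 := neg_abs_le (pos p - pos q)
  unfold toVertex
  rw [h.src_eq, h.tgt_eq]
  rcases min_cases (pos q + vertexDist A (src q) v) (rem q + vertexDist A (tgt q) v) with k | k
  · rw [k.1]; exact (min_le_left _ _).trans (by linarith)
  · rw [k.1]; exact (min_le_right _ _).trans (by linarith [h1.1, h1.2])

theorem pathDist_le_through (p q : CayleyPoint A) : pathDist p q ≤ through p q := by
  unfold pathDist
  split_ifs
  · exact min_le_right _ _
  · exact le_rfl

theorem SameEdge.pathDist_le {p q : CayleyPoint A} (h : SameEdge p q) :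
    pathDist p q ≤ |pos p - pos q| := by
  unfold pathDist
  rw [if_pos h]
  exact min_le_left _ _

theorem pathDist_cases (p q : CayleyPoint A) :
    pathDist p q = through p q ∨ (SameEdge p q ∧ pathDist p q = |pos p - pos q|) := by
  unfold pathDist
  split_ifs with h
  · rcases min_choice |pos p - pos q| (through p q) with k | k
    · exact Or.inr ⟨h, k⟩
    · exact Or.inl k
  · exact Or.inl rfl

theorem pathDist_self (p : CayleyPoint A) : pathDist p p = 0 := by
  apply le_antisymm
  · cases p with
    | vertex s =>
      refine (pathDist_le_through _ _).trans ((min_le_left _ _).trans ?_)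
      have := toVertex_src (vertex s : CayleyPoint A)
      simpa [pos] using this
    | edge s a t =>
      have h : SameEdge (edge s a t) (edge s a t) := ⟨rfl, rfl⟩
      simpa using h.pathDist_le
  · rcases pathDist_cases p p with h | h
    · rw [h]; exact through_nonneg _ _
    · rw [h.2]; exact abs_nonneg _

theorem pathDist_comm (hA : Submonoid.closure A = ⊤) (p q : CayleyPoint A) :
    pathDist p q = pathDist q p := by
  unfold pathDist
  rw [through_comm hA p q, abs_sub_comm]
  by_cases h : SameEdge p q
  · rw [if_pos h, if_pos h.symm]
  · rw [if_neg h, if_neg fun k => h k.symm]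

theorem pathDist_triangle (hA : Submonoid.closure A = ⊤) (p q r : CayleyPoint A) :
    pathDist p r ≤ pathDist p q + pathDist q r := by
  rcases pathDist_cases p q with h | ⟨h, h'⟩ <;> rcases pathDist_cases q r with k | ⟨k, k'⟩
  · obtain ⟨v, w, -, -, e1⟩ := through_eq p q
    obtain ⟨v', w', -, -, e2⟩ := through_eq q r
    have i1 := toVertex_add_ge q w v' hA
    have i2 := toVertex_triangle hA p v w
    have i3 := toVertex_triangle hA p w v'
    have i4 := toVertex_triangle hA p v' w'
    have i5 := through_le hA p r w'
    have i6 := pathDist_le_through p r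
    linarith
  · obtain ⟨v, w, -, -, e1⟩ := through_eq p q
    have i1 := k.symm.toVertex_le w
    have i2 := toVertex_triangle hA p v w
    have i5 := through_le hA p r w
    have i6 := pathDist_le_through p r
    rw [abs_sub_comm] at i1
    linarith
  · obtain ⟨v, w, -, -, e1⟩ := through_eq q r
    have i1 := h.toVertex_le v
    have i2 := toVertex_triangle hA p v w
    have i5 := through_le hA p r w
    have i6 := pathDist_le_through p r
    linarith
  · have i1 := (h.trans k).pathDist_le
    have i2 := abs_sub_le (pos p) (pos q) (pos r)
    linarith

theorem toVertex_edge_pos (s : S) (a : A) (t : Set.Ioo (0 : ℝ) 1) (v : S) :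
    0 < toVertex (edge s a t) v :=
  lt_min (add_pos_of_pos_of_nonneg t.2.1 (vertexDist_nonneg _ _))
    (add_pos_of_pos_of_nonneg (sub_pos.2 t.2.2) (vertexDist_nonneg _ _))

theorem eq_of_pathDist_eq_zero (hA : Submonoid.closure A = ⊤) {p q : CayleyPoint A}
    (h : pathDist p q = 0) : p = q := by
  rcases pathDist_cases p q with k | ⟨k, k'⟩
  · obtain ⟨v, w, -, -, e⟩ := through_eq p q
    have n1 := toVertex_nonneg p v
    have n2 := toVertex_nonneg q w
    have n3 := vertexDist_nonneg (A := A) v w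
    cases p with
    | edge s a t => linarith [toVertex_edge_pos s a t v]
    | vertex s =>
      cases q with
      | edge s a t => linarith [toVertex_edge_pos s a t w]
      | vertex s' =>
        have h0 : through (vertex s : CayleyPoint A) (vertex s') = 0 := by rw [← k, h]
        simp only [through, toVertex, src, tgt, pos, rem, zero_add, add_zero, min_self] at h0
        have h1 : (cayleyGraph A).dist s s' = 0 := Nat.cast_eq_zero.1 h0
        rw [((cayleyGraph_connected hA).dist_eq_zero_iff).1 h1]
  · rw [h] at k'
    have h1 : pos p = pos q := sub_eq_zero.1 (abs_eq_zero.1 k'.symm)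
    cases p with
    | vertex s => exact k.elim
    | edge s a t =>
      cases q with
      | vertex s' => exact k.elim
      | edge s' a' t' =>
        obtain ⟨rfl, rfl⟩ := k
        rw [Subtype.ext (show (t : ℝ) = t' from h1)]

end CayleyPoint

/-- The geometric realisation of the Cayley graph of `S` with respect to a generating set `A`. -/
def CayleySpace (A : Set S) (_hA : Submonoid.closure A = ⊤) : Type u :=
  CayleyPoint A

open CayleyPoint in
noncomputable instance CayleySpace.instMetricSpace (A : Set S) (hA : Submonoid.closure A = ⊤) :
    MetricSpace (CayleySpace A hA) where
  dist := fun p q : CayleyPoint A => pathDist p q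
  dist_self := pathDist_self
  dist_comm := pathDist_comm hA
  dist_triangle := pathDist_triangle hA
  eq_of_dist_eq_zero := eq_of_pathDist_eq_zero hA

namespace CayleySpace

open CayleyPoint

variable {A : Set S} {hA : Submonoid.closure A = ⊤}

variable (A hA) in
/-- A vertex, as a point of the geometric realisation. -/
def ofVertex (s : S) : CayleySpace A hA := (vertex s : CayleyPoint A)

variable (A hA) in
open Classical in
/-- The closed edge from `s` to `s * a`, parametrised by `[0, 1]`. -/
noncomputable def edgeMap (s : S) (a : A) (t : ℝ) : CayleySpace A hA :=
  if h : t ∈ Set.Ioo (0 : ℝ) 1 then (edge s a ⟨t, h⟩ : CayleyPoint A)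
  else if t ≤ 0 then ofVertex A hA s else ofVertex A hA (s * a)

theorem edgeMap_zero (s : S) (a : A) : edgeMap A hA s a 0 = ofVertex A hA s := by
  simp [edgeMap]

theorem edgeMap_one (s : S) (a : A) : edgeMap A hA s a 1 = ofVertex A hA (s * a) := by
  simp [edgeMap]

theorem edgeMap_of_mem (s : S) (a : A) (t : Set.Ioo (0 : ℝ) 1) :
    edgeMap A hA s a t = (edge s a t : CayleyPoint A) :=
  dif_pos t.2

theorem dist_ofVertex (u v : S) :
    dist (ofVertex A hA u) (ofVertex A hA v) = vertexDist A u v := by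
  change pathDist (vertex u : CayleyPoint A) (vertex v) = _
  have hn : ¬ SameEdge (vertex u : CayleyPoint A) (vertex v) := fun h => h
  unfold pathDist
  rw [if_neg hn]
  simp [through, toVertex, src, tgt, pos, rem]

theorem dist_le_toVertex (p : CayleyPoint A) (v : S) :
    dist (α := CayleySpace A hA) p (ofVertex A hA v) ≤ toVertex p v := by
  change pathDist p (vertex v) ≤ _
  refine (pathDist_le_through _ _).trans ((min_le_left _ _).trans ?_)
  simp [src, pos]

theorem dist_edgeMap_le (s : S) (a : A) {t t' : ℝ} (ht : t ∈ Set.Icc (0 : ℝ) 1)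
    (ht' : t' ∈ Set.Icc (0 : ℝ) 1) (h : t ≤ t') :
    dist (edgeMap A hA s a t) (edgeMap A hA s a t') ≤ t' - t := by
  rcases h.eq_or_lt with rfl | h
  · simp
  rcases ht.1.eq_or_lt with rfl | h0 <;> rcases ht'.2.eq_or_lt with rfl | h1
  · rw [edgeMap_zero, edgeMap_one, dist_ofVertex, sub_zero]
    have := vertexDist_src_tgt (edge s a ⟨1 / 2, by norm_num⟩ : CayleyPoint A)
    simp only [src, tgt, pos, rem] at this
    linarith
  · rw [dist_comm, edgeMap_zero, edgeMap_of_mem s a ⟨t', h, h1⟩]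
    refine (dist_le_toVertex _ _).trans ((toVertex_src (edge s a ⟨t', h, h1⟩)).trans ?_)
    simp [pos]
  · rw [edgeMap_one, edgeMap_of_mem s a ⟨t, h0, h⟩]
    exact (dist_le_toVertex _ _).trans (toVertex_tgt (edge s a ⟨t, h0, h⟩))
  · rw [edgeMap_of_mem s a ⟨t', h0.trans h, h1⟩, edgeMap_of_mem s a ⟨t, h0, h.trans h1⟩]
    have hs : SameEdge (edge s a ⟨t, h0, h.trans h1⟩) (edge s a ⟨t', h0.trans h, h1⟩) := ⟨rfl, rfl⟩
    refine hs.pathDist_le.trans ?_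
    simp only [pos]
    rw [abs_sub_comm, abs_of_nonneg (by linarith)]

/-- A segment of an edge is a geodesic as soon as it is not longer than the distance of its ends. -/
theorem edgeMap_geodesic (s : S) (a : A) {t t' : ℝ} (ht : t ∈ Set.Icc (0 : ℝ) 1)
    (ht' : t' ∈ Set.Icc (0 : ℝ) 1) (h : t ≤ t')
    (hd : t' - t ≤ dist (edgeMap A hA s a t) (edgeMap A hA s a t')) :
    ∃ γ, IsGeodesic γ (edgeMap A hA s a t) (edgeMap A hA s a t') := by
  have hd' := le_antisymm (dist_edgeMap_le s a ht ht' h) hd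
  have main : ∀ x ∈ Set.Icc 0 (t' - t), ∀ y ∈ Set.Icc 0 (t' - t), x ≤ y →
      dist (edgeMap A hA s a (t + x)) (edgeMap A hA s a (t + y)) = y - x := by
    intro x hx y hy hxy
    have hx' : t + x ∈ Set.Icc (0 : ℝ) 1 := ⟨by linarith [ht.1, hx.1], by linarith [ht'.2, hx.2]⟩
    have hy' : t + y ∈ Set.Icc (0 : ℝ) 1 := ⟨by linarith [ht.1, hy.1], by linarith [ht'.2, hy.2]⟩
    have i1 := dist_edgeMap_le (hA := hA) s a ht hx' (by linarith [hx.1])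
    have i2 := dist_edgeMap_le (hA := hA) s a hx' hy' (by linarith)
    have i3 := dist_edgeMap_le (hA := hA) s a hy' ht' (by linarith [hy.2])
    have i4 := dist_triangle4 (edgeMap A hA s a t) (edgeMap A hA s a (t + x))
      (edgeMap A hA s a (t + y)) (edgeMap A hA s a t')
    linarith
  refine ⟨fun x => edgeMap A hA s a (t + x), by simp, by simp [hd'], ?_⟩
  rw [hd']
  intro x hx y hy
  rcases le_total x y with hxy | hxy
  · rw [main x hx y hy hxy, abs_sub_comm, abs_of_nonneg (by linarith)]
  · rw [dist_comm, main y hy x hx hxy, abs_of_nonneg (by linarith)]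

theorem exists_geodesic_symm {x y : CayleySpace A hA} (h : ∃ γ, IsGeodesic γ x y) :
    ∃ γ, IsGeodesic γ y x :=
  let ⟨_, hγ⟩ := h
  ⟨_, hγ.symm⟩

theorem exists_geodesic_trans {x y z : CayleySpace A hA} (h : ∃ γ, IsGeodesic γ x y)
    (k : ∃ γ, IsGeodesic γ y z) (hd : dist x y + dist y z ≤ dist x z) :
    ∃ γ, IsGeodesic γ x z :=
  let ⟨_, hγ⟩ := h
  let ⟨_, hη⟩ := k
  ⟨_, hγ.concat hη hd⟩

theorem exists_geodesic_of_adj {u v : S} (h : (cayleyGraph A).Adj u v) :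
    ∃ γ, IsGeodesic γ (ofVertex A hA u) (ofVertex A hA v) := by
  have main : ∀ (s : S) (a : A), (cayleyGraph A).Adj s (s * a) →
      ∃ γ, IsGeodesic γ (ofVertex A hA s) (ofVertex A hA (s * a)) := by
    intro s a h
    rw [← edgeMap_zero s a, ← edgeMap_one s a]
    refine edgeMap_geodesic s a (by simp) (by simp) zero_le_one ?_
    rw [edgeMap_zero, edgeMap_one, dist_ofVertex, vertexDist, SimpleGraph.dist_eq_one_iff_adj.2 h]
    simp
  obtain ⟨_, ⟨a, ha, rfl⟩ | ⟨a, ha, rfl⟩⟩ := id h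
  · exact main u ⟨a, ha⟩ h
  · exact exists_geodesic_symm (main v ⟨a, ha⟩ h.symm)

theorem exists_geodesic_ofVertex (u v : S) :
    ∃ γ, IsGeodesic γ (ofVertex A hA u) (ofVertex A hA v) := by
  obtain ⟨w, hw⟩ := (cayleyGraph_connected hA).exists_walk_length_eq_dist u v
  induction w with
  | nil => exact ⟨_, IsGeodesic.refl _⟩
  | @cons u x v hadj p ih =>
    have h1 : (cayleyGraph A).dist x v ≤ p.length := SimpleGraph.dist_le p
    have h2 := (cayleyGraph_connected hA).dist_triangle (u := u) (v := x) (w := v)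
    have h3 := SimpleGraph.dist_eq_one_iff_adj.2 hadj
    rw [SimpleGraph.Walk.length_cons] at hw
    refine exists_geodesic_trans (exists_geodesic_of_adj hadj) (ih (by omega)) ?_
    simp only [dist_ofVertex, vertexDist]
    exact_mod_cast (by omega)

theorem exists_geodesic_src (p : CayleyPoint A)
    (h : pos p ≤ dist (α := CayleySpace A hA) p (ofVertex A hA (src p))) :
    ∃ γ, IsGeodesic (X := CayleySpace A hA) γ p (ofVertex A hA (src p)) := by
  cases p with
  | vertex s => exact exists_geodesic_ofVertex s s
  | edge s a t =>
    apply exists_geodesic_symm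
    have e := edgeMap_of_mem (hA := hA) s a t
    simp only [src, pos] at h ⊢
    rw [← e, ← edgeMap_zero s a] at h ⊢
    refine edgeMap_geodesic s a (by simp) (Set.Ioo_subset_Icc_self t.2) t.2.1.le ?_
    rw [dist_comm, sub_zero]
    exact h

theorem exists_geodesic_tgt (p : CayleyPoint A)
    (h : rem p ≤ dist (α := CayleySpace A hA) p (ofVertex A hA (tgt p))) :
    ∃ γ, IsGeodesic (X := CayleySpace A hA) γ p (ofVertex A hA (tgt p)) := by
  cases p with
  | vertex s => exact exists_geodesic_ofVertex s s
  | edge s a t =>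
    have e := edgeMap_of_mem (hA := hA) s a t
    simp only [tgt, rem] at h ⊢
    rw [← e, ← edgeMap_one s a] at h ⊢
    exact edgeMap_geodesic s a (Set.Ioo_subset_Icc_self t.2) (by simp) t.2.2.le h

theorem exists_end (p : CayleyPoint A) (v : S) :
    ∃ (w : S) (c : ℝ), c + vertexDist A w v ≤ toVertex p v ∧
      dist (α := CayleySpace A hA) p (ofVertex A hA w) ≤ c ∧
      (c ≤ dist (α := CayleySpace A hA) p (ofVertex A hA w) →
        ∃ γ, IsGeodesic (X := CayleySpace A hA) γ p (ofVertex A hA w)) := by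
  rcases min_cases (pos p + vertexDist A (src p) v) (rem p + vertexDist A (tgt p) v) with h | h
  · exact ⟨src p, pos p, h.1.ge, (dist_le_toVertex _ _).trans (toVertex_src p),
      exists_geodesic_src p⟩
  · exact ⟨tgt p, rem p, h.1.ge, (dist_le_toVertex _ _).trans (toVertex_tgt p),
      exists_geodesic_tgt p⟩

/-- The geometric realisation of a Cayley graph is a geodesic space. -/
theorem isGeodesicSpace (A : Set S) (hA : Submonoid.closure A = ⊤) :
    IsGeodesicSpace (CayleySpace A hA) := by
  intro p q
  rcases pathDist_cases (A := A) p q with h | ⟨h, h'⟩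
  · have hpq : dist p q = through (A := A) p q := h
    have main : ∀ (w : S) (c : ℝ), dist q (ofVertex A hA w) ≤ c →
        toVertex (A := A) p w + c = dist p q →
        (c ≤ dist q (ofVertex A hA w) → ∃ γ, IsGeodesic γ q (ofVertex A hA w)) →
        ∃ γ, IsGeodesic γ p q := by
      intro w c h1 h2 h3
      obtain ⟨v, b, k1, k2, k3⟩ := exists_end (hA := hA) p w
      have i1 := dist_triangle p (ofVertex A hA v) q
      have i2 := dist_triangle (ofVertex A hA v) (ofVertex A hA w) q
      have i4 := dist_comm (ofVertex A hA w) q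
      have i3 := dist_ofVertex (hA := hA) v w
      refine exists_geodesic_trans (k3 (by linarith)) (exists_geodesic_trans
        (exists_geodesic_ofVertex v w) (exists_geodesic_symm (h3 (by linarith))) ?_) ?_
      · linarith
      · linarith
    rcases min_choice (toVertex (A := A) p (src q) + pos q)
      (toVertex (A := A) p (tgt q) + rem q) with k | k
    · exact main (src q) (pos q) ((dist_le_toVertex _ _).trans (toVertex_src q))
        (k.symm.trans hpq.symm) (exists_geodesic_src q)
    · exact main (tgt q) (rem q) ((dist_le_toVertex _ _).trans (toVertex_tgt q))
        (k.symm.trans hpq.symm) (exists_geodesic_tgt q)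
  · cases p with
    | vertex s => exact h.elim
    | edge s a t =>
      cases q with
      | vertex s' => exact h.elim
      | edge s' a' t' =>
        obtain ⟨rfl, rfl⟩ := h
        have e := edgeMap_of_mem (hA := hA) s a t
        have e' := edgeMap_of_mem (hA := hA) s a t'
        have hd : dist (edgeMap A hA s a t) (edgeMap A hA s a t') = |(t : ℝ) - t'| := by
          rw [e, e']; exact h'
        rw [← e, ← e']
        rcases le_total (t : ℝ) t' with ht | ht
        · refine edgeMap_geodesic s a (Set.Ioo_subset_Icc_self t.2)
            (Set.Ioo_subset_Icc_self t'.2) ht ?_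
          rw [hd, abs_sub_comm]; exact le_abs_self _
        · apply exists_geodesic_symm
          refine edgeMap_geodesic s a (Set.Ioo_subset_Icc_self t'.2)
            (Set.Ioo_subset_Icc_self t.2) ht ?_
          rw [dist_comm, hd]; exact le_abs_self _

end CayleySpace

/-- The monoid `S` is hyperbolic: its Cayley graph with respect to some finite generating set is a
hyperbolic geodesic space. -/
def IsHyperbolicMonoid (S : Type u) [Monoid S] : Prop :=
  ∃ (A : Set S) (hA : Submonoid.closure A = ⊤), A.Finite ∧ IsHyperbolicSpace (CayleySpace A hA)

/-- The monoid `S` is finitely generated and of finite geometric type. -/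
def IsFiniteGeometricType (S : Type u) [Monoid S] : Prop :=
  ∃ A : Set S, A.Finite ∧ Submonoid.closure A = ⊤ ∧
    ∃ n : ℕ, ∀ q : S, ∀ a ∈ A, {x : S | x * a = q}.encard ≤ n

end Cayley

/-- The subsemigroup `T` is large in `S`, and `S` is a small extension of `T`: the Rees index
`|S - T| + 1` is finite. -/
def IsLargeSubsemigroup {S : Type u} [Mul S] (T : Subsemigroup S) : Prop :=
  ((T : Set S)ᶜ).Finite

/-! For any finite generating sets of `S` and `T`, the two Cayley graphs are quasi-isometric
(`isHyperbolicSpace_cayley_iff`), and hyperbolicity of geodesic spaces pulls back along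
quasi-isometric embeddings (`IsHyperbolicSpace.of_quasiIsometric`).

The inclusion of `T` is Lipschitz because right multiplication by a fixed element moves every vertex
a bounded distance. The substance lies in the converse: if `t` and `t * a` are both in `T`, their
distance within `T` must be bounded, although the generator `a` of `S` may lie outside `T`. Finite
geometric type makes right translations finite-to-one, so `t * a` leaves `T` for only finitely many
`t`. Reading a word for `t` from the right, its suffixes are therefore soon carried into `T` by `a`,
which gives `t = v * u` with `u` in a fixed finite set and `u * a` in `T`
(`exists_finite_suffixes`). Then `t = v * u` and `t * a = v * (u * a)` are both at bounded distance
from `v` in `T`. The finitely many exceptional vertices only enlarge the constants. In direction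
(2), `T` also needs a finite generating set, obtained by a rewriting argument of Schreier type
(`exists_finite_closure_eq_top`).

Invariance of hyperbolicity rests on the Morse lemma: a geodesic and a quasi-geodesic with the same
ends stay uniformly close. Quasi-geodesics are taken as discrete chains of points, so no continuity
or path length is needed for them. -/

section CoarseGeometry

universe v

variable {X : Type u} [MetricSpace X] {x y : X} {γ : ℝ → X}

/-! ### Geodesic segments and thin polygons. -/

theorem IsGeodesic.dist_left (h : IsGeodesic γ x y) {t : ℝ} (ht : t ∈ Set.Icc 0 (dist x y)) :
    dist x (γ t) = t := by
  have := h.2.2 0 ⟨le_rfl, dist_nonneg⟩ t ht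
  rwa [h.1, zero_sub, abs_neg, abs_of_nonneg ht.1] at this

theorem IsGeodesic.dist_left_le (h : IsGeodesic γ x y) {u : X} (hu : u ∈ geodesicTrace γ x y) :
    dist x u ≤ dist x y := by
  obtain ⟨t, ht, rfl⟩ := hu
  rw [h.dist_left ht]
  exact ht.2

theorem geodesicTrace_symm (γ : ℝ → X) (x y : X) :
    geodesicTrace (fun t => γ (dist x y - t)) y x = geodesicTrace γ x y := by
  ext u
  constructor
  · rintro ⟨t, ht, rfl⟩
    rw [dist_comm] at ht
    exact ⟨_, ⟨sub_nonneg.2 ht.2, sub_le_self _ ht.1⟩, rfl⟩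
  · rintro ⟨t, ht, rfl⟩
    refine ⟨dist x y - t, ?_, by simp⟩
    rw [dist_comm y x]
    exact ⟨sub_nonneg.2 ht.2, sub_le_self _ ht.1⟩

theorem IsGeodesic.left_mem (h : IsGeodesic γ x y) : x ∈ geodesicTrace γ x y :=
  ⟨0, ⟨le_rfl, dist_nonneg⟩, h.1⟩

/-- A segment of a geodesic is a geodesic. -/
theorem IsGeodesic.segment (h : IsGeodesic γ x y) {a b : ℝ} (ha : 0 ≤ a) (hab : a ≤ b)
    (hb : b ≤ dist x y) :
    IsGeodesic (fun s => γ (a + s)) (γ a) (γ b) ∧ dist (γ a) (γ b) = b - a := by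
  have hd : dist (γ a) (γ b) = b - a := by
    rw [h.2.2 a ⟨ha, hab.trans hb⟩ b ⟨ha.trans hab, hb⟩, abs_sub_comm,
      abs_of_nonneg (sub_nonneg.2 hab)]
  refine ⟨⟨by simp, by simp [hd], ?_⟩, hd⟩
  rw [hd]
  intro s hs t ht
  rw [h.2.2 _ ⟨by linarith [hs.1], by linarith [hs.2]⟩ _ ⟨by linarith [ht.1], by linarith [ht.2]⟩,
    add_sub_add_left_eq_sub]

theorem HasThinTriangles.nonneg {δ : ℝ} (hδ : HasThinTriangles X δ) (x : X) : 0 ≤ δ := by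
  have h := IsGeodesic.refl x
  obtain ⟨w, -, hw⟩ := hδ x x x _ _ _ h h h x h.left_mem
  exact dist_nonneg.trans hw.le

/-- In a geodesic quadrilateral, a point of one side is close to one of the three other sides. -/
theorem HasThinTriangles.quadrilateral {δ : ℝ} (hδ : HasThinTriangles X δ)
    (hX : IsGeodesicSpace X) {a b c d : X} {α β γ η : ℝ → X} (hα : IsGeodesic α a b)
    (hβ : IsGeodesic β a d) (hγ : IsGeodesic γ d c) (hη : IsGeodesic η b c) {u : X}
    (hu : u ∈ geodesicTrace α a b) :
    ∃ w ∈ geodesicTrace β a d ∪ geodesicTrace γ d c ∪ geodesicTrace η b c, dist u w ≤ 2 * δ := by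
  have h0 := hδ.nonneg a
  -- The diagonal cuts the quadrilateral into two triangles, each costing `δ`.
  obtain ⟨θ, hθ⟩ := hX c a
  obtain ⟨w, hw | hw, huw⟩ := hδ _ _ _ _ _ _ hα hη hθ u hu
  · exact ⟨w, Or.inr hw, by linarith⟩
  · obtain ⟨w', hw', hww⟩ := hδ _ _ _ _ _ _ hθ hβ hγ w hw
    exact ⟨w', Or.inl hw', by linarith [dist_triangle u w w']⟩

/-! ### The Morse lemma: stability of quasi-geodesic chains. -/

/-- A geodesic stays logarithmically close to any chain with the same ends. -/
theorem HasThinTriangles.exists_dist_chain_le {δ K : ℝ} (hδ : HasThinTriangles X δ)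
    (hX : IsGeodesicSpace X) {c : ℕ → X} (hc : ∀ k, dist (c k) (c (k + 1)) ≤ K) (m : ℕ) :
    ∀ i j : ℕ, i ≤ j → j ≤ i + 2 ^ m → ∀ γ : ℝ → X, IsGeodesic γ (c i) (c j) →
      ∀ u ∈ geodesicTrace γ (c i) (c j), ∃ k ≤ j, dist u (c k) ≤ δ * m + K := by
  have hK : 0 ≤ K := dist_nonneg.trans (hc 0)
  induction m with
  | zero =>
    intro i j hij hji γ hγ u hu
    refine ⟨i, hij, ?_⟩
    have h := hγ.dist_left_le hu
    rw [dist_comm] at h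
    have h2 : dist (c i) (c j) ≤ K := by
      rcases hij.eq_or_lt with rfl | hlt
      · simpa using hK
      · obtain rfl : j = i + 1 := by simp at hji; omega
        exact hc i
    simpa using h.trans h2
  | succ m ih =>
    intro i j hij hji γ hγ u hu
    have h0 := hδ.nonneg u
    have hle : ∀ k : ℕ, (∃ v, dist u v < δ ∧ dist v (c k) ≤ δ * m + K) →
        dist u (c k) ≤ δ * (m + 1 : ℕ) + K := by
      rintro k ⟨v, h1, h2⟩
      have := dist_triangle u v (c k)
      push_cast
      linarith
    by_cases hs : j ≤ i + 2 ^ m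
    · obtain ⟨k, hk, h⟩ := ih i j hij hs γ hγ u hu
      refine ⟨k, hk, h.trans ?_⟩
      push_cast
      linarith
    · push Not at hs
      obtain ⟨β, hβ⟩ := hX (c (i + 2 ^ m)) (c j)
      obtain ⟨α, hα⟩ := hX (c i) (c (i + 2 ^ m))
      obtain ⟨w, hw | hw, huw⟩ := hδ _ _ _ _ _ _ hγ hβ.symm hα.symm u hu
      · rw [geodesicTrace_symm] at hw
        obtain ⟨k, hk, h⟩ := ih _ _ hs.le (by rw [pow_succ] at hji; omega) β hβ w hw
        exact ⟨k, hk, hle k ⟨w, huw, h⟩⟩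
      · rw [geodesicTrace_symm] at hw
        obtain ⟨k, hk, h⟩ := ih _ _ (Nat.le_add_right _ _) le_rfl α hα w hw
        exact ⟨k, hk.trans hs.le, hle k ⟨w, huw, h⟩⟩

/-- Exponential growth beats linear growth. With `m` of the order of a logarithm, this closes the
self-referential estimate in the Morse lemma. -/
theorem exists_bound_of_two_pow_le (A B : ℝ) :
    ∃ m₀ : ℕ, ∀ m : ℕ, (2 : ℝ) ^ m ≤ A + B * m → m ≤ m₀ := by
  have h0 := tendsto_pow_const_div_const_pow_of_one_lt 0 (one_lt_two (α := ℝ))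
  have h1 := tendsto_pow_const_div_const_pow_of_one_lt 1 (one_lt_two (α := ℝ))
  have h := (h0.const_mul A).add (h1.const_mul B)
  simp only [mul_zero, add_zero] at h
  obtain ⟨m₀, hm⟩ := Filter.eventually_atTop.1 (h.eventually (gt_mem_nhds one_pos))
  refine ⟨m₀, fun m hle => ?_⟩
  by_contra! hlt
  have h2 := hm m hlt.le
  have hp : (0 : ℝ) < 2 ^ m := by positivity
  rw [pow_zero, pow_one, ← mul_div_assoc, ← mul_div_assoc, ← add_div, div_lt_one hp] at h2
  linarith

/-- A linear quantity bounded by a logarithm of itself is bounded. -/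
theorem exists_bound_of_le_log (a b M : ℝ) (hM : 0 ≤ M) (hb : 0 ≤ b) :
    ∃ R : ℝ, ∀ (D : ℝ) (N : ℕ), N ≤ M * D + M →
      D ≤ a + b * (Nat.log 2 (N + 1) + 1 : ℕ) → D ≤ R := by
  obtain ⟨m₀, hm₀⟩ := exists_bound_of_two_pow_le (2 * (M * a + M + 1)) (2 * (M * b))
  refine ⟨a + b * m₀, fun D N hN hD => hD.trans ?_⟩
  -- With `m` the exponent on the left, `2 ^ m ≤ 2 * (M * D + M + 1)` and `D ≤ a + b * m` combine
  -- into the inequality defining `m₀`. The shift to `N + 1` covers `N = 0`.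
  have h1 : (2 : ℝ) ^ (Nat.log 2 (N + 1) + 1) ≤ 2 * (N + 1) := by
    have := Nat.pow_log_le_self 2 (x := N + 1) (by omega)
    rw [pow_succ, mul_comm]
    have h : (2 : ℝ) ^ Nat.log 2 (N + 1) ≤ N + 1 := by exact_mod_cast this
    linarith
  have h2 := mul_le_mul_of_nonneg_left hD hM
  have h3 := hm₀ (Nat.log 2 (N + 1) + 1) (by linarith)
  have h4 : ((Nat.log 2 (N + 1) + 1 : ℕ) : ℝ) ≤ m₀ := by exact_mod_cast h3
  have := mul_le_mul_of_nonneg_left h4 hb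
  linarith

/-- A chain of points `c 0, …, c n` which is a discrete quasi-geodesic. -/
structure IsQuasiGeodesicChain (K : ℝ) (c : ℕ → X) (n : ℕ) : Prop where
  step : ∀ k, dist (c k) (c (k + 1)) ≤ K
  lower : ∀ i ≤ n, ∀ j ≤ n, i ≤ j → (j : ℝ) - i ≤ K * dist (c i) (c j) + K

theorem IsQuasiGeodesicChain.nonneg {K : ℝ} {c : ℕ → X} {n : ℕ} (h : IsQuasiGeodesicChain K c n) :
    0 ≤ K :=
  dist_nonneg.trans (h.step 0)

/-- A geodesic is close to every quasi-geodesic chain with the same ends. -/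
theorem HasThinTriangles.geodesic_near_chain {δ : ℝ} (hδ : HasThinTriangles X δ)
    (hX : IsGeodesicSpace X) (K : ℝ) :
    ∃ R : ℝ, ∀ (c : ℕ → X) (n : ℕ) (γ : ℝ → X), IsQuasiGeodesicChain K c n →
      IsGeodesic γ (c 0) (c n) → ∀ u ∈ geodesicTrace γ (c 0) (c n),
        ∃ k ≤ n, dist u (c k) ≤ R := by
  by_cases hne : Nonempty X
  swap
  · exact ⟨0, fun c => (hne ⟨c 0⟩).elim⟩
  have hδ0 : 0 ≤ δ := hδ.nonneg hne.some
  by_cases hK : 0 ≤ K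
  swap
  · exact ⟨0, fun c n γ hc => (hK hc.nonneg).elim⟩
  obtain ⟨R, hR⟩ := exists_bound_of_le_log (2 * δ + K) δ (6 * K) (by positivity) hδ0
  refine ⟨R, fun c n γ hc hγ => ?_⟩
  set L := dist (c 0) (c n) with hL
  have hL0 : 0 ≤ L := dist_nonneg
  set V : Set X := c '' Set.Iic n with hV
  have hVne : V.Nonempty := ⟨c 0, 0, Nat.zero_le n, rfl⟩
  have hVc : IsCompact V := ((Set.finite_Iic n).image c).isCompact
  have hcont : ContinuousOn (fun t => Metric.infDist (γ t) V) (Set.Icc 0 L) := by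
    have : LipschitzOnWith 1 γ (Set.Icc 0 L) :=
      LipschitzOnWith.of_dist_le_mul fun s hs t ht => by
        rw [hγ.2.2 s hs t ht, NNReal.coe_one, one_mul, Real.dist_eq]
    exact (Metric.continuous_infDist_pt V).comp_continuousOn this.continuousOn
  -- `γ t₀` is a point of the geodesic farthest from the chain; its distance `D` is what has to be
  -- bounded.
  obtain ⟨t₀, ht₀, hmax⟩ := isCompact_Icc.exists_isMaxOn ⟨0, le_rfl, hL0⟩ hcont
  set D := Metric.infDist (γ t₀) V with hD
  have hD0 : 0 ≤ D := Metric.infDist_nonneg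
  have near : ∀ t ∈ Set.Icc 0 L, ∃ k ≤ n, dist (γ t) (c k) ≤ D := by
    intro t ht
    obtain ⟨v, ⟨k, hk, rfl⟩, hv⟩ := hVc.exists_infDist_eq_dist hVne (γ t)
    exact ⟨k, hk, hv ▸ hmax ht⟩
  have far : ∀ k ≤ n, D ≤ dist (γ t₀) (c k) := fun k hk =>
    Metric.infDist_le_dist_of_mem ⟨k, hk, rfl⟩
  suffices hDR : D ≤ R by
    rintro _ ⟨t, ht, rfl⟩
    obtain ⟨k, hk, h⟩ := near t ht
    exact ⟨k, hk, h.trans hDR⟩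
  -- Go back `2 * D` from `t₀`, or to the end of the geodesic if that comes first, and join to the
  -- chain by a segment of length at most `D` (in the second case, of length zero). Either way the
  -- segment keeps distance at least `D` from `γ t₀`.
  have left : ∃ a, 0 ≤ a ∧ a ≤ t₀ ∧ t₀ - a ≤ 2 * D ∧ ∃ k ≤ n, dist (γ a) (c k) ≤ D ∧
      ∀ w, dist (γ a) w ≤ dist (γ a) (c k) → D ≤ dist (γ t₀) w := by
    by_cases h : 2 * D ≤ t₀
    · obtain ⟨k, hk, h'⟩ := near (t₀ - 2 * D) ⟨by linarith, by linarith [ht₀.2]⟩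
      refine ⟨t₀ - 2 * D, by linarith, by linarith, by linarith, k, hk, h', fun w hw => ?_⟩
      have e := (hγ.segment (a := t₀ - 2 * D) (b := t₀) (by linarith) (by linarith) ht₀.2).2
      have := dist_triangle_right (γ (t₀ - 2 * D)) (γ t₀) w
      linarith
    · refine ⟨0, le_rfl, ht₀.1, by linarith, 0, Nat.zero_le n, ?_, fun w hw => ?_⟩
      · rw [hγ.1, dist_self]; exact hD0
      · rw [hγ.1, dist_self, dist_le_zero] at hw
        exact hw ▸ far 0 (Nat.zero_le n)
  have right : ∃ b, t₀ ≤ b ∧ b ≤ L ∧ b - t₀ ≤ 2 * D ∧ ∃ k ≤ n, dist (γ b) (c k) ≤ D ∧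
      ∀ w, dist (γ b) w ≤ dist (γ b) (c k) → D ≤ dist (γ t₀) w := by
    by_cases h : t₀ + 2 * D ≤ L
    · obtain ⟨k, hk, h'⟩ := near (t₀ + 2 * D) ⟨by linarith [ht₀.1], h⟩
      refine ⟨t₀ + 2 * D, by linarith, h, by linarith, k, hk, h', fun w hw => ?_⟩
      have e := (hγ.segment (a := t₀) (b := t₀ + 2 * D) ht₀.1 (by linarith) h).2
      have := dist_triangle_right (γ t₀) (γ (t₀ + 2 * D)) w
      linarith
    · refine ⟨L, ht₀.2, le_rfl, by linarith, n, le_rfl, ?_, fun w hw => ?_⟩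
      · rw [hγ.2.1, dist_self]; exact hD0
      · rw [hγ.2.1, dist_self, dist_le_zero] at hw
        exact hw ▸ far n le_rfl
  obtain ⟨a, ha0, hat, hta, i, hi, hai, hfa⟩ := left
  obtain ⟨b, htb, hbL, hbt, j, hj, hbj, hfb⟩ := right
  obtain ⟨hseg, hab⟩ := hγ.segment ha0 (hat.trans htb) hbL
  have hu : γ t₀ ∈ geodesicTrace (fun s => γ (a + s)) (γ a) (γ b) :=
    ⟨t₀ - a, by rw [hab]; exact ⟨by linarith, by linarith⟩, by simp⟩
  -- At most `4 * D` along the geodesic plus `D` for each connecting segment.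
  have hij : dist (c i) (c j) ≤ 6 * D := by
    have := dist_triangle4_left (γ a) (γ b) (c i) (c j)
    linarith
  obtain ⟨β, hβ⟩ := hX (γ a) (c i)
  obtain ⟨η, hη⟩ := hX (γ b) (c j)
  obtain ⟨θ, hθ⟩ := hX (c i) (c j)
  obtain ⟨w, hw, huw⟩ := hδ.quadrilateral hX hseg hβ hθ hη hu
  have hlog : ∀ N : ℕ, 0 ≤ δ * (Nat.log 2 (N + 1) + 1 : ℕ) := fun N => by positivity
  have small : D ≤ 2 * δ → D ≤ R := fun h =>
    hR D 0 (by simp; positivity) (by linarith [hlog 0])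
  rcases hw with (hw | hw) | hw
  · exact small ((hfa w (hβ.dist_left_le hw)).trans huw)
  -- The remaining side is the chord from `c i` to `c j`. The chain between them has `N` steps,
  -- linearly bounded in `D`, while `D` exceeds its logarithm by a bounded factor and summand at
  -- most.
  · have fin : ∀ N : ℕ, (N : ℝ) ≤ K * dist (c i) (c j) + K →
        (∃ k ≤ n, dist w (c k) ≤ δ * (Nat.log 2 (N + 1) + 1 : ℕ) + K) → D ≤ R := by
      rintro N hN ⟨k, hk, h⟩
      have e1 := mul_le_mul_of_nonneg_left hij hK
      have e2 := far k hk
      have e3 := dist_triangle (γ t₀) w (c k)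
      exact hR D N (by linarith) (by linarith)
    have pow : ∀ N : ℕ, N ≤ 2 ^ (Nat.log 2 (N + 1) + 1) := fun N =>
      (Nat.le_succ N).trans (Nat.lt_pow_succ_log_self one_lt_two (N + 1)).le
    rcases le_total i j with h | h
    · refine fin (j - i) (by rw [Nat.cast_sub h]; exact hc.lower i hi j hj h) ?_
      obtain ⟨k, hk, h'⟩ := hδ.exists_dist_chain_le hX hc.step
        (Nat.log 2 (j - i + 1) + 1) i j h
        (by have := pow (j - i); omega) θ hθ w hw
      exact ⟨k, hk.trans hj, h'⟩
    · refine fin (i - j) (by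
        rw [Nat.cast_sub h, dist_comm]; exact hc.lower j hj i hi h) ?_
      rw [← geodesicTrace_symm] at hw
      obtain ⟨k, hk, h'⟩ := hδ.exists_dist_chain_le hX hc.step
        (Nat.log 2 (i - j + 1) + 1) j i h
        (by have := pow (i - j); omega) _ hθ.symm w hw
      exact ⟨k, hk.trans hi, h'⟩
  · exact small ((hfb w (hη.dist_left_le hw)).trans huw)

theorem dist_chain_le {K : ℝ} {c : ℕ → X} (hc : ∀ k, dist (c k) (c (k + 1)) ≤ K) {i k : ℕ}
    (hik : i ≤ k) : dist (c i) (c k) ≤ K * (k - i : ℝ) := by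
  induction k, hik using Nat.le_induction with
  | base => simp
  | succ k hk ih =>
    have := dist_triangle (c i) (c k) (c (k + 1))
    have := hc k
    push_cast
    linarith

/-- A quasi-geodesic chain is close to every geodesic with the same ends. -/
theorem HasThinTriangles.chain_near_geodesic {δ : ℝ} (hδ : HasThinTriangles X δ)
    (hX : IsGeodesicSpace X) (K : ℝ) :
    ∃ R : ℝ, ∀ (c : ℕ → X) (n : ℕ) (γ : ℝ → X), IsQuasiGeodesicChain K c n →
      IsGeodesic γ (c 0) (c n) → ∀ k ≤ n,
        ∃ u ∈ geodesicTrace γ (c 0) (c n), dist (c k) u ≤ R := by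
  obtain ⟨R, hR⟩ := hδ.geodesic_near_chain hX K
  refine ⟨K * (K * (2 * R + 1) + K) + R, fun c n γ hc hγ k hk => ?_⟩
  have hK := hc.nonneg
  have hL0 : 0 ≤ dist (c 0) (c n) := dist_nonneg
  have hR0 : 0 ≤ R := by
    obtain ⟨k, -, h⟩ := hR c n γ hc hγ _ hγ.left_mem
    exact dist_nonneg.trans h
  -- Times at which the geodesic is near the part of the chain up to `k`. A time `t` within `1` of
  -- the supremum suffices: either `t + 1` lies beyond it, hence is near a later part, or the end of
  -- the geodesic, which is `c n`, plays that role.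
  set P : Set ℝ := {t | t ∈ Set.Icc 0 (dist (c 0) (c n)) ∧ ∃ i ≤ k, dist (γ t) (c i) ≤ R}
  have hP0 : (0 : ℝ) ∈ P :=
    ⟨⟨le_rfl, hL0⟩, 0, Nat.zero_le k, by rw [hγ.1, dist_self]; exact hR0⟩
  have hPb : BddAbove P := ⟨_, fun t ht => ht.1.2⟩
  obtain ⟨t, ⟨ht, i, hik, hi⟩, hlt⟩ := exists_lt_of_lt_csSup ⟨0, hP0⟩ (sub_one_lt (sSup P))
  have : ∃ t' ∈ Set.Icc 0 (dist (c 0) (c n)), t ≤ t' ∧ t' ≤ t + 1 ∧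
      ∃ j ≤ n, k ≤ j ∧ dist (γ t') (c j) ≤ R := by
    by_cases h : t + 1 ≤ dist (c 0) (c n)
    · have hm : t + 1 ∈ Set.Icc 0 (dist (c 0) (c n)) := ⟨by linarith [ht.1], h⟩
      obtain ⟨j, hj, hj'⟩ := hR c n γ hc hγ _ ⟨t + 1, hm, rfl⟩
      refine ⟨t + 1, hm, by linarith, le_rfl, j, hj, ?_, hj'⟩
      by_contra! hlt'
      have := le_csSup hPb (show t + 1 ∈ P from ⟨hm, j, hlt'.le, hj'⟩)
      linarith
    · exact ⟨_, ⟨hL0, le_rfl⟩, ht.2, by linarith, n, le_rfl, hk,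
        by rw [hγ.2.1, dist_self]; exact hR0⟩
  obtain ⟨t', ht', htt, htt', j, hjn, hkj, hj⟩ := this
  refine ⟨γ t, ⟨t, ht, rfl⟩, ?_⟩
  have e1 := (hγ.segment ht.1 htt ht'.2).2
  have e2 := dist_triangle4_left (γ t) (γ t') (c i) (c j)
  have e3 := hc.lower i (hik.trans hk) j hjn (hik.trans hkj)
  have e4 := dist_chain_le hc.step hik
  have e5 := mul_le_mul_of_nonneg_left (show dist (c i) (c j) ≤ 2 * R + 1 by linarith) hK
  have hkj' : (k : ℝ) ≤ j := by exact_mod_cast hkj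
  -- Since `i ≤ k ≤ j`, the bound on `j - i` also bounds the number of steps from `c i` to `c k`.
  have e6 := mul_le_mul_of_nonneg_left (show (k : ℝ) - i ≤ K * (2 * R + 1) + K by linarith) hK
  have e7 := dist_triangle_left (c k) (γ t) (c i)
  rw [dist_comm (c i) (γ t)] at e7
  linarith

/-! ### Hyperbolicity along quasi-isometric embeddings. -/

variable {Y : Type v} [MetricSpace Y]

/-- The image of a geodesic under a quasi-isometric embedding is close to a quasi-geodesic chain. -/
theorem exists_chain_of_quasiIsometric {K : ℝ} (hK : 1 ≤ K) {f : Y → X}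
    (hf : ∀ p q, dist (f p) (f q) ≤ K * dist p q + K)
    (hf' : ∀ p q, dist p q ≤ K * dist (f p) (f q) + K) {x y : Y} {α : ℝ → Y}
    (hα : IsGeodesic α x y) :
    ∃ (c : ℕ → X) (n : ℕ), IsQuasiGeodesicChain (2 * K) c n ∧ c 0 = f x ∧ c n = f y ∧
      (∀ k, ∃ v ∈ geodesicTrace α x y, c k = f v) ∧
      ∀ u ∈ geodesicTrace α x y, ∃ k ≤ n, dist (f u) (c k) ≤ 2 * K := by
  set L := dist x y with hL
  have hL0 : 0 ≤ L := dist_nonneg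
  have hmem : ∀ k : ℕ, min (k : ℝ) L ∈ Set.Icc 0 L := fun k =>
    ⟨le_min k.cast_nonneg hL0, min_le_right _ _⟩
  -- Sample `α` at integer times. Truncation at `L` makes the chain constant from `⌈L⌉₊` on, so the
  -- step bound holds for all indices.
  refine ⟨fun k => f (α (min (k : ℝ) L)), ⌈L⌉₊, ⟨fun k => ?_, fun i hi j hj hij => ?_⟩, ?_, ?_,
    fun k => ⟨_, ⟨_, hmem k, rfl⟩, rfl⟩, ?_⟩
  · refine (hf _ _).trans ?_
    rw [hα.2.2 _ (hmem k) _ (hmem (k + 1))]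
    have : |min (k : ℝ) L - min ((k + 1 : ℕ) : ℝ) L| ≤ 1 := by
      refine (abs_min_sub_min_le_max _ _ _ _).trans ?_
      simp
    have := mul_le_mul_of_nonneg_left this (zero_le_one.trans hK)
    linarith
  · have h1 := hf' (α (min (i : ℝ) L)) (α (min (j : ℝ) L))
    rw [hα.2.2 _ (hmem i) _ (hmem j)] at h1
    have h2 := neg_abs_le (min (i : ℝ) L - min (j : ℝ) L)
    -- Truncation loses less than `1`, which is absorbed by the additive constant because `1 ≤ K`.
    have h3 : (j : ℝ) - 1 ≤ min (j : ℝ) L := by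
      refine le_min (by linarith) ?_
      have h4 : (j : ℝ) ≤ ⌈L⌉₊ := by exact_mod_cast hj
      linarith [Nat.ceil_lt_add_one hL0]
    have h5 := min_le_left (i : ℝ) L
    have h6 : 0 ≤ K * dist (f (α (min (i : ℝ) L))) (f (α (min (j : ℝ) L))) := by positivity
    linarith
  · simp [hL0, hα.1]
  · change f (α (min (⌈L⌉₊ : ℝ) L)) = f y
    rw [min_eq_right (Nat.le_ceil L), hα.2.1]
  · rintro _ ⟨t, ht, rfl⟩
    refine ⟨⌊t⌋₊, (Nat.floor_mono ht.2).trans (Nat.floor_le_ceil L), (hf _ _).trans ?_⟩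
    have h1 := Nat.floor_le ht.1
    have h2 := Nat.lt_floor_add_one t
    rw [hα.2.2 _ ht _ (hmem _), min_eq_left (h1.trans ht.2), abs_of_nonneg (by linarith)]
    have := mul_le_mul_of_nonneg_left (show t - ⌊t⌋₊ ≤ 1 by linarith) (zero_le_one.trans hK)
    linarith

/-- A geodesic space which embeds quasi-isometrically in a hyperbolic space is hyperbolic. -/
theorem IsHyperbolicSpace.of_quasiIsometric (hX : IsHyperbolicSpace X) (hY : IsGeodesicSpace Y)
    {K : ℝ} (hK : 1 ≤ K) {f : Y → X} (hf : ∀ p q, dist (f p) (f q) ≤ K * dist p q + K)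
    (hf' : ∀ p q, dist p q ≤ K * dist (f p) (f q) + K) : IsHyperbolicSpace Y := by
  obtain ⟨hX, δ, hδ⟩ := hX
  obtain ⟨R₁, hR₁⟩ := hδ.geodesic_near_chain hX (2 * K)
  obtain ⟨R₂, hR₂⟩ := hδ.chain_near_geodesic hX (2 * K)
  -- Path behind the constant: `f u` to the chain (`2 * K`), to the side `α'` (`R₂`), to another
  -- side (`δ`), to `f v` (`R₁`), then back to `Y` by `hf'`. The final `1` makes the inequality
  -- strict.
  refine ⟨hY, K * (2 * K + R₂ + δ + R₁) + K + 1, fun x y z α β γ hα hβ hγ u hu => ?_⟩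
  obtain ⟨α', hα'⟩ := hX (f x) (f y)
  obtain ⟨β', hβ'⟩ := hX (f y) (f z)
  obtain ⟨γ', hγ'⟩ := hX (f z) (f x)
  have side : ∀ (p q : Y) (η : ℝ → Y) (η' : ℝ → X), IsGeodesic η p q → IsGeodesic η' (f p) (f q) →
      ∀ w ∈ geodesicTrace η' (f p) (f q), ∃ v ∈ geodesicTrace η p q, dist w (f v) ≤ R₁ := by
    intro p q η η' hη hη' w hw
    obtain ⟨c, n, hc, h0, hn, hv, -⟩ := exists_chain_of_quasiIsometric hK hf hf' hη
    rw [← h0, ← hn] at hη' hw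
    obtain ⟨k, -, h⟩ := hR₁ c n η' hc hη' w hw
    obtain ⟨v, hv, hk⟩ := hv k
    exact ⟨v, hv, hk ▸ h⟩
  obtain ⟨w, hw, huw⟩ : ∃ w ∈ geodesicTrace α' (f x) (f y), dist (f u) w ≤ 2 * K + R₂ := by
    obtain ⟨c, n, hc, h0, hn, -, hu'⟩ := exists_chain_of_quasiIsometric hK hf hf' hα
    obtain ⟨k, hk, h⟩ := hu' u hu
    rw [← h0, ← hn] at hα' ⊢
    obtain ⟨w, hw, h'⟩ := hR₂ c n α' hc hα' k hk
    exact ⟨w, hw, (dist_triangle _ _ _).trans (add_le_add h h')⟩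
  obtain ⟨w', hw', hww⟩ := hδ _ _ _ _ _ _ hα' hβ' hγ' w hw
  obtain ⟨v, hv, hwv⟩ : ∃ v ∈ geodesicTrace β y z ∪ geodesicTrace γ z x, dist w' (f v) ≤ R₁ := by
    rcases hw' with hw' | hw'
    · obtain ⟨v, hv, h⟩ := side _ _ _ _ hβ hβ' w' hw'
      exact ⟨v, Or.inl hv, h⟩
    · obtain ⟨v, hv, h⟩ := side _ _ _ _ hγ hγ' w' hw'
      exact ⟨v, Or.inr hv, h⟩
  refine ⟨v, hv, ?_⟩
  have e1 := dist_triangle4 (f u) w w' (f v)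
  have e2 := mul_le_mul_of_nonneg_left
    (show dist (f u) (f v) ≤ 2 * K + R₂ + δ + R₁ by linarith) (zero_le_one.trans hK)
  linarith [hf' u v]

end CoarseGeometry

/-! ### Vertex distances and maps between Cayley graphs. -/

section MonoidGeometry

universe v

variable {S : Type u} {T : Type v} [Monoid S] [Monoid T]

theorem vertexDist_mul_le_one {A : Set S} (s : S) {a : S} (ha : a ∈ A) :
    vertexDist A s (s * a) ≤ 1 := by
  by_cases h : s = s * a
  · rw [← h, CayleyPoint.vertexDist_self]; exact zero_le_one
  · have hadj : (cayleyGraph A).Adj s (s * a) := ⟨h, Or.inl ⟨a, ha, rfl⟩⟩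
    simp [vertexDist, SimpleGraph.dist_eq_one_iff_adj.2 hadj]

/-- Right multiplication by a fixed element moves vertices by a bounded amount. -/
theorem exists_vertexDist_mul_le {A : Set S} (hA : Submonoid.closure A = ⊤) (u : S) :
    ∃ K : ℝ, ∀ s : S, vertexDist A s (s * u) ≤ K := by
  have hu : u ∈ Submonoid.closure A := by rw [hA]; trivial
  induction hu using Submonoid.closure_induction_right with
  | one => exact ⟨0, fun s => by rw [mul_one, CayleyPoint.vertexDist_self]⟩
  | mul_right x _ y hy ih =>
    obtain ⟨K, hK⟩ := ih
    refine ⟨K + 1, fun s => ?_⟩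
    rw [← mul_assoc]
    exact (CayleyPoint.vertexDist_triangle hA _ (s * x) _).trans
      (add_le_add (hK s) (vertexDist_mul_le_one _ hy))

/-- Takes the maximum of finitely many constants, over generators, suffixes or exceptional vertices.
-/
theorem Set.Finite.exists_uniform_bound {ι : Type*} {I : Set ι} (hI : I.Finite)
    {P : ι → ℝ → Prop} (hP : ∀ i ∈ I, ∀ K K', K ≤ K' → P i K → P i K')
    (h : ∀ i ∈ I, ∃ K, P i K) : ∃ K, ∀ i ∈ I, P i K := by
  choose! f hf using h
  obtain ⟨K, hK⟩ := (hI.image f).bddAbove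
  exact ⟨K, fun i hi => hP i hi _ _ (hK ⟨i, hi, rfl⟩) (hf i hi)⟩

/-- A map between the vertex sets which moves the ends of edges a bounded amount apart is
Lipschitz. -/
theorem vertexDist_map_le {A : Set S} (hA : Submonoid.closure A = ⊤) {B : Set T}
    (hB : Submonoid.closure B = ⊤) (h : S → T) {K : ℝ}
    (hK : ∀ a ∈ A, ∀ s, vertexDist B (h s) (h (s * a)) ≤ K) (u v : S) :
    vertexDist B (h u) (h v) ≤ K * vertexDist A u v := by
  have hadj : ∀ u v, (cayleyGraph A).Adj u v → vertexDist B (h u) (h v) ≤ K := by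
    rintro u v ⟨-, ⟨a, ha, rfl⟩ | ⟨a, ha, rfl⟩⟩
    · exact hK a ha u
    · rw [CayleyPoint.vertexDist_comm]
      exact hK a ha v
  obtain ⟨p, hp⟩ := (cayleyGraph_connected hA).exists_walk_length_eq_dist u v
  rw [vertexDist, vertexDist, ← hp, ← vertexDist]
  clear hp
  induction p with
  | nil => simp [CayleyPoint.vertexDist_self]
  | @cons u x v e p ih =>
    have := CayleyPoint.vertexDist_triangle hB (h u) (h x) (h v)
    have := hadj u x e
    rw [SimpleGraph.Walk.length_cons]
    push_cast
    linarith

/-- In a monoid of finite geometric type, right translations are finite-to-one. -/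
theorem IsFiniteGeometricType.finite_preimage (hS : IsFiniteGeometricType S) (a : S) :
    ∀ {C : Set S}, C.Finite → {x | x * a ∈ C}.Finite := by
  obtain ⟨A, -, hA, n, hn⟩ := hS
  have ha : a ∈ Submonoid.closure A := by rw [hA]; trivial
  induction ha using Submonoid.closure_induction_right with
  | one => intro C hC; simpa using hC
  | mul_right x _ y hy ih =>
    intro C hC
    have h : {z | z * y ∈ C}.Finite := by
      refine hC.preimage' fun q _ => ?_
      exact Set.finite_of_encard_le_coe (k := n) (hn q y hy)
    simpa [mul_assoc] using ih h

/-- Vertices are dense in the Cayley graph. -/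
theorem CayleySpace.dist_src_le {A : Set S} {hA : Submonoid.closure A = ⊤} (p : CayleySpace A hA) :
    dist p (CayleySpace.ofVertex A hA (CayleyPoint.src p)) ≤ 1 := by
  refine (CayleySpace.dist_le_toVertex _ _).trans ((CayleyPoint.toVertex_src _).trans ?_)
  cases p with
  | vertex s => exact zero_le_one
  | edge s a t => exact t.2.2.le

/-- Hyperbolicity passes from one Cayley graph to another along a quasi-isometric embedding of the
vertex sets. -/
theorem IsHyperbolicSpace.of_vertexDist {A : Set S} {hA : Submonoid.closure A = ⊤} {B : Set T}
    {hB : Submonoid.closure B = ⊤} (hX : IsHyperbolicSpace (CayleySpace A hA)) (h : T → S) {K : ℝ}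
    (h1 : ∀ u v, vertexDist A (h u) (h v) ≤ K * vertexDist B u v)
    (h2 : ∀ u v, vertexDist B u v ≤ K * vertexDist A (h u) (h v) + K) :
    IsHyperbolicSpace (CayleySpace B hB) := by
  have hK0 : 0 ≤ K := by
    have := h2 1 1
    rw [CayleyPoint.vertexDist_self, CayleyPoint.vertexDist_self] at this
    linarith
  -- Replacing both points by initial vertices of their edges changes the distance by at most `2`;
  -- hence `2 * K + 2`.
  refine hX.of_quasiIsometric (CayleySpace.isGeodesicSpace B hB) (K := 2 * K + 2) (by linarith)
    (f := fun p => CayleySpace.ofVertex A hA (h (CayleyPoint.src p))) (fun p q => ?_)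
    (fun p q => ?_) <;> rw [CayleySpace.dist_ofVertex]
  all_goals
    have hp := CayleySpace.dist_src_le p
    have hq := CayleySpace.dist_src_le q
    have hv := CayleySpace.dist_ofVertex (hA := hB) (CayleyPoint.src p) (CayleyPoint.src q)
  · have h3 := h1 (CayleyPoint.src p) (CayleyPoint.src q)
    have h4 := dist_triangle4_left p q (CayleySpace.ofVertex B hB (CayleyPoint.src p))
      (CayleySpace.ofVertex B hB (CayleyPoint.src q))
    have h5 := mul_le_mul_of_nonneg_left
      (show vertexDist B (CayleyPoint.src p) (CayleyPoint.src q) ≤ dist p q + 2 by linarith) hK0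
    have h6 : 0 ≤ (K + 2) * dist p q := by positivity
    linarith
  · have h3 := h2 (CayleyPoint.src p) (CayleyPoint.src q)
    have h4 := dist_triangle4_right p q (CayleySpace.ofVertex B hB (CayleyPoint.src p))
      (CayleySpace.ofVertex B hB (CayleyPoint.src q))
    have h5 : 0 ≤ (K + 2) * vertexDist A (h (CayleyPoint.src p)) (h (CayleyPoint.src q)) :=
      mul_nonneg (by linarith) (CayleyPoint.vertexDist_nonneg _ _)
    linarith

/-! ### A large subsemigroup and its ambient monoid. -/

section SmallExtension

variable (φ : T →ₙ* S)

/-- An edge labelled `b` is sent to a right translation by `φ b`, and the finitely many `φ b` have a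
common displacement bound. Only multiplicativity is used, so `φ 1` need not be `1`. -/
theorem exists_vertexDist_hom_le {A : Set S} (hA : Submonoid.closure A = ⊤) {B : Set T}
    (hBf : B.Finite) (hB : Submonoid.closure B = ⊤) :
    ∃ K : ℝ, ∀ u v, vertexDist A (φ u) (φ v) ≤ K * vertexDist B u v := by
  obtain ⟨K, hK⟩ := hBf.exists_uniform_bound
    (P := fun b K => ∀ s : S, vertexDist A s (s * φ b) ≤ K)
    (fun _ _ K K' h h' s => (h' s).trans h) fun b _ => exists_vertexDist_mul_le hA (φ b)
  refine ⟨K, vertexDist_map_le hB hA φ fun b hb t => ?_⟩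
  rw [map_mul]
  exact hK b hb _

/-- Every element of a finitely generated large subsemigroup, with finitely many exceptions, has a
suffix from a fixed finite set which right multiplication by `a` maps into the subsemigroup. -/
theorem exists_finite_suffixes (hφ : Function.Injective φ) (hC : (Set.range φ)ᶜ.Finite)
    (hS : IsFiniteGeometricType S) {B : Set T} (hBf : B.Finite) (hB : Submonoid.closure B = ⊤)
    (a : S) :
    ∃ G : Set T, G.Finite ∧ {t | φ t * a ∉ Set.range φ}.Finite ∧
      ∀ t : T, φ t * a ∉ Set.range φ ∨
        ∃ v, ∃ u ∈ G, t = v * u ∧ φ u * a ∈ Set.range φ := by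
  have hF : {t | φ t * a ∉ Set.range φ}.Finite :=
    (hS.finite_preimage a hC).preimage hφ.injOn
  refine ⟨insert 1 (Set.image2 (· * ·) B {t | φ t * a ∉ Set.range φ}),
    (hBf.image2 _ hF).insert _, hF, fun t => ?_⟩
  have ht : t ∈ Submonoid.closure B := by rw [hB]; trivial
  induction ht using Submonoid.closure_induction_left with
  | one =>
    by_cases h : φ 1 * a ∈ Set.range φ
    · exact Or.inr ⟨1, 1, Set.mem_insert _ _, by simp, h⟩
    · exact Or.inl h
  -- Generators are prepended one at a time. When an exceptional `t` becomes a non-exceptional `b *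
  -- t`, that product is taken as `u`; whatever is prepended later goes into `v`.
  | mul_left b hb t _ ih =>
    rcases ih with ih | ⟨v, u, hu, rfl, h⟩
    · by_cases h : φ (b * t) * a ∈ Set.range φ
      · exact Or.inr ⟨1, b * t, Or.inr ⟨b, hb, t, ih, rfl⟩, by simp, h⟩
      · exact Or.inl h
    · exact Or.inr ⟨b * v, u, hu, by rw [mul_assoc], h⟩

/-- A left inverse of the inclusion of a large subsemigroup is Lipschitz. -/
theorem exists_vertexDist_leftInverse_le (hφ : Function.Injective φ) (hC : (Set.range φ)ᶜ.Finite)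
    (hS : IsFiniteGeometricType S) {A : Set S} (hAf : A.Finite) (hA : Submonoid.closure A = ⊤)
    {B : Set T} (hBf : B.Finite) (hB : Submonoid.closure B = ⊤) {ψ : S → T}
    (hψ : Function.LeftInverse ψ φ) :
    ∃ K : ℝ, ∀ u v, vertexDist B (ψ u) (ψ v) ≤ K * vertexDist A u v := by
  obtain ⟨K, hK⟩ := hAf.exists_uniform_bound
    (P := fun a K => ∀ s : S, vertexDist B (ψ s) (ψ (s * a)) ≤ K)
    (fun _ _ K K' h h' s => (h' s).trans h) fun a _ => by
      obtain ⟨G, hG, hF, hG'⟩ := exists_finite_suffixes φ hφ hC hS hBf hB a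
      -- Bounds the detour from `v * u` through `v` to `v * ψ (φ u * a)`, uniformly in `v`.
      obtain ⟨K₁, hK₁⟩ := hG.exists_uniform_bound
        (P := fun u K => ∀ v : T, vertexDist B v (v * u) + vertexDist B v (v * ψ (φ u * a)) ≤ K)
        (fun _ _ K K' h h' s => (h' s).trans h) fun u _ => by
          obtain ⟨K, hK⟩ := exists_vertexDist_mul_le hB u
          obtain ⟨K', hK'⟩ := exists_vertexDist_mul_le hB (ψ (φ u * a))
          exact ⟨K + K', fun v => add_le_add (hK v) (hK' v)⟩
      -- Edges that start outside the subsemigroup or leave it: for fixed `a` there are finitely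
      -- many.
      obtain ⟨K₂, hK₂⟩ := (hC.union (hF.image φ)).exists_uniform_bound
        (P := fun s K => vertexDist B (ψ s) (ψ (s * a)) ≤ K)
        (fun _ _ K K' h h' => h'.trans h) fun s _ => ⟨_, le_rfl⟩
      refine ⟨max K₁ K₂, fun s => ?_⟩
      by_cases hs : s ∈ (Set.range φ)ᶜ ∪ φ '' {t | φ t * a ∉ Set.range φ}
      · exact (hK₂ s hs).trans (le_max_right _ _)
      · simp only [Set.mem_union, not_or, Set.mem_compl_iff, not_not] at hs
        obtain ⟨⟨t, rfl⟩, ht⟩ := hs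
        rcases hG' t with h | ⟨v, u, hu, rfl, w, hw⟩
        · exact (ht ⟨t, h, rfl⟩).elim
        · have h1 := hK₁ u hu v
          have h2 := CayleyPoint.vertexDist_triangle hB (v * u) v (v * w)
          rw [CayleyPoint.vertexDist_comm (v * u) v] at h2
          rw [← hw, hψ w] at h1
          rw [hψ, map_mul, mul_assoc, ← hw, ← map_mul, hψ]
          exact (h2.trans h1).trans (le_max_left _ _)
  exact ⟨K, vertexDist_map_le hA hB ψ hK⟩

/-- A large subsemigroup of a finitely generated monoid is finitely generated. -/
theorem exists_finite_closure_eq_top (hφ : Function.Injective φ) (hC : (Set.range φ)ᶜ.Finite)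
    {A : Set S} (hAf : A.Finite) (hA : Submonoid.closure A = ⊤) :
    ∃ B : Set T, B.Finite ∧ Submonoid.closure B = ⊤ := by
  set C : Set S := insert 1 (Set.range φ)ᶜ
  -- `c` is a prefix of the word that is trivial or still outside the subsemigroup, `a` the letter
  -- that brings it inside, and `d` a remainder that lies outside or is trivial.
  set B : Set T := {t | ∃ c ∈ C, ∃ a ∈ insert 1 A, ∃ d ∈ C, c * a * d = φ t}
  have hCf : C.Finite := hC.insert 1
  refine ⟨B, ?_, ?_⟩
  · refine Set.Finite.subset (((hCf.image2 (· * ·) (hAf.insert 1)).image2 (· * ·) hCf).preimage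
      hφ.injOn) ?_
    rintro t ⟨c, hc, a, ha, d, hd, h⟩
    exact ⟨c * a, ⟨c, hc, a, ha, rfl⟩, d, hd, h⟩
  · have main : ∀ s : S, ∀ c ∈ C, ∀ t, φ t = c * s → t ∈ Submonoid.closure B := by
      intro s
      have hs : s ∈ Submonoid.closure A := by rw [hA]; trivial
      induction hs using Submonoid.closure_induction_left with
      | one =>
        intro c hc t ht
        exact Submonoid.subset_closure
          ⟨c, hc, 1, Set.mem_insert _ _, 1, Set.mem_insert _ _, by rw [ht, mul_one]⟩
      | mul_left a ha s _ ih =>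
        intro c hc t ht
        by_cases h : c * a ∈ Set.range φ
        · obtain ⟨t₁, h₁⟩ := h
          by_cases h' : s ∈ Set.range φ
          · obtain ⟨t₂, rfl⟩ := h'
            have h₂ := ih 1 (Set.mem_insert _ _) t₂ (one_mul _).symm
            obtain rfl : t = t₁ * t₂ := hφ (by rw [ht, map_mul, h₁, mul_assoc])
            refine mul_mem (Submonoid.subset_closure ?_) h₂
            exact ⟨c, hc, a, Or.inr ha, 1, Set.mem_insert _ _, by rw [mul_one, h₁]⟩
          · exact Submonoid.subset_closure
              ⟨c, hc, a, Or.inr ha, s, Or.inr h', by rw [ht, mul_assoc]⟩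
        -- As long as the prefix stays outside, it is carried along as the new `c`.
        · exact ih (c * a) (Or.inr h) t (by rw [ht, mul_assoc])
    exact eq_top_iff.2 fun t _ => main (φ t) 1 (Set.mem_insert _ _) t (one_mul _).symm

/-- The Cayley graphs of a monoid of finite geometric type and of a large subsemigroup are
quasi-isometric, so that one is hyperbolic if and only if the other is. -/
theorem isHyperbolicSpace_cayley_iff (hφ : Function.Injective φ) (hC : (Set.range φ)ᶜ.Finite)
    (hS : IsFiniteGeometricType S) {A : Set S} (hAf : A.Finite) (hA : Submonoid.closure A = ⊤)
    {B : Set T} (hBf : B.Finite) (hB : Submonoid.closure B = ⊤) :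
    IsHyperbolicSpace (CayleySpace B hB) ↔ IsHyperbolicSpace (CayleySpace A hA) := by
  -- Outside the image `ψ` takes an arbitrary value, harmless because only finitely many vertices
  -- are affected.
  set ψ : S → T := Function.invFun φ
  have hψ : Function.LeftInverse ψ φ := Function.leftInverse_invFun hφ
  obtain ⟨K₁, h₁⟩ := exists_vertexDist_hom_le φ hA hBf hB
  obtain ⟨K₂, h₂⟩ := exists_vertexDist_leftInverse_le φ hφ hC hS hAf hA hBf hB hψ
  obtain ⟨K₃, h₃⟩ := hC.exists_uniform_bound (P := fun s K => vertexDist A s (φ (ψ s)) ≤ K)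
    (fun _ _ K K' h h' => h'.trans h) fun s _ => ⟨_, le_rfl⟩
  have h₃' : ∀ s, vertexDist A s (φ (ψ s)) ≤ max K₃ 0 := by
    intro s
    by_cases hs : s ∈ Set.range φ
    · obtain ⟨t, rfl⟩ := hs
      rw [hψ, CayleyPoint.vertexDist_self]
      exact le_max_right _ _
    · exact (h₃ s hs).trans (le_max_left _ _)
  -- The term `2 * max K₃ 0` pays for replacing both `u` and `v` by `φ (ψ u)` and `φ (ψ v)`.
  set K := max (max K₁ K₂) (2 * max K₃ 0)
  have hK₁ : K₁ ≤ K := (le_max_left _ _).trans (le_max_left _ _)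
  have hK₂ : K₂ ≤ K := (le_max_right _ _).trans (le_max_left _ _)
  have hK₃ : 2 * max K₃ 0 ≤ K := le_max_right _ _
  have hK : 0 ≤ K := le_trans (by positivity) hK₃
  constructor
  · refine fun h => h.of_vertexDist ψ (K := K) (fun u v => (h₂ u v).trans ?_) fun u v => ?_
    · exact mul_le_mul_of_nonneg_right hK₂ (CayleyPoint.vertexDist_nonneg _ _)
    · have e1 := CayleyPoint.vertexDist_triangle hA u (φ (ψ u)) v
      have e2 := CayleyPoint.vertexDist_triangle hA (φ (ψ u)) (φ (ψ v)) v
      rw [CayleyPoint.vertexDist_comm (φ (ψ v)) v] at e2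
      have e3 := h₁ (ψ u) (ψ v)
      have e4 := mul_le_mul_of_nonneg_right hK₁
        (CayleyPoint.vertexDist_nonneg (A := B) (ψ u) (ψ v))
      linarith [h₃' u, h₃' v]
  · refine fun h => h.of_vertexDist φ (K := K) (fun u v => (h₁ u v).trans ?_) fun u v => ?_
    · exact mul_le_mul_of_nonneg_right hK₁ (CayleyPoint.vertexDist_nonneg _ _)
    · have e1 := h₂ (φ u) (φ v)
      rw [hψ, hψ] at e1
      have e2 := mul_le_mul_of_nonneg_right hK₂
        (CayleyPoint.vertexDist_nonneg (A := A) (φ u) (φ v))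
      linarith

end SmallExtension

end MonoidGeometry

/-- The subsemigroup is the image of an injective `φ : T →ₙ* S`, so that `T` carries its own
identity. The equivalence holds for all finite generating sets, so any available pair serves: `A`
from finite geometric type in (1), `B` from `exists_finite_closure_eq_top` in (2). -/
theorem mainTheorem3 {S : Type*} {T : Type*} [Monoid S] [Monoid T] (φ : T →ₙ* S)
    (hφ : Function.Injective φ) (hlarge : IsLargeSubsemigroup (MulHom.srange φ))
    (hS : IsFiniteGeometricType S) :
    (IsHyperbolicMonoid T → IsHyperbolicMonoid S) ∧
      (IsHyperbolicMonoid S → IsHyperbolicMonoid T) := by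
  have hC : (Set.range φ)ᶜ.Finite := by
    rw [← MulHom.coe_srange]
    exact hlarge
  constructor
  · rintro ⟨B, hB, hBf, h⟩
    obtain ⟨A, hAf, hA, -⟩ := id hS
    exact ⟨A, hA, hAf, (isHyperbolicSpace_cayley_iff φ hφ hC hS hAf hA hBf hB).1 h⟩
  · rintro ⟨A, hA, hAf, h⟩
    obtain ⟨B, hBf, hB⟩ := exists_finite_closure_eq_top φ hφ hC hAf hA
    exact ⟨B, hB, hBf, (isHyperbolicSpace_cayley_iff φ hφ hC hS hAf hA hBf hB).2 h⟩
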